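/- Let $\mu_1,\mu_2\in[-\pi,\pi)$, $\kappa_1,\kappa_2\ge 0$ and $\lambda,\kappa_3\in\mathbb{R}$. The bivariate von Mises sine distribution is the probability distribution on $[-\pi,\pi)^2$ with Lebesgue density proportional to $$\exp\{\kappa_1\cos(\theta-\mu_1)+\kappa_2\cos(\phi-\mu_2)+\lambda\sin(\theta-\mu_1)\sin(\phi-\mu_2)\},$$ and the bivariate von Mises cosine distribution is the one with density proportional to $$\exp\{\kappa_1\cos(\theta-\mu_1)+\kappa_2\cos(\phi-\mu_2)+\kappa_3\cos(\theta-\mu_1-\phi+\mu_2)\}.$$ For a pair $(\Theta,\Phi)$ of random angles and centres $m_1,m_2\in\mathbb{R}$ let $$\rho_{\mathrm{JS}}(m_1,m_2)=\frac{E[\sin(\Theta-m_1)\sin(\Phi-m_2)]}{\sqrt{E[\sin^2(\Theta-m_1)]\,E[\sin^2(\Phi-m_2)]}}$$ be the Jammalamadaka--Sarma circular correlation coefficient, and write $\rho_{\mathrm{JS}}=\rho_{\mathrm{JS}}(\mu_1,\mu_2)$ for the coefficient centred at the location parameters $\mu_1,\mu_2$ of the model. Let $\operatorname{sgn}(x)=\mathbf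 1_{(0,\infty)}(x)-\mathbf 1_{(-\infty,0)}(x)$. (a) If $(\Theta,\Phi)$ follows the sine distribution, then $\operatorname{sgn}(\rho_{\mathrm{JS}})=\operatorname{sgn}(\lambda)$. If $(\Theta,\Phi)$ follows the cosine distribution, then $\operatorname{sgn}(\rho_{\mathrm{JS}})=\operatorname{sgn}(\kappa_3)$. Hence in both models $\rho_{\mathrm{JS}}=0$ implies that $\Theta$ and $\Phi$ are independent. (b) Suppose in addition that $\Theta$ and $\Phi$ have circular means $m_1,m_2$, that is, $E[e^{i\Theta}]=R_1e^{im_1}$ and $E[e^{i\Phi}]=R_2e^{im_2}$ with $R_1,R_2>0$. In the sine model $\operatorname{sgn}(\rho_{\mathrm{JS}}(m_1,m_2))=\operatorname{sgn}(\lambda)$. In the cosine model $$\operatorname{sgn}(\rho_{\mathrm{JS}}(m_1,m_2))=\operatorname{sgn}(\kappa_3)\,\operatorname{sgn}(\cos(m_1-\mu_1))\,\operatorname{sgn}(\cos(m_2-\mu_2)),$$ which is $\operatorname{sgn}(\kappa_3)$ when $\mu_1,\mu_2$ are the circular means. In both models $\rho_{\mathrm{JS}}(m_1,m_2)=0$ implies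 that $\Theta$ and $\Phi$ are independent. -/

import Mathlib

open MeasureTheory ProbabilityTheory

noncomputable section

/-- The square `[-π, π)²`, on which a pair of angles takes its values. -/
def angleSquare : Set (ℝ × ℝ) :=
  Set.Ico (-Real.pi) Real.pi ×ˢ Set.Ico (-Real.pi) Real.pi

/-- The unnormalised density of the bivariate von Mises sine model. -/
def vmSineWeight (μ₁ μ₂ κ₁ κ₂ lam : ℝ) (p : ℝ × ℝ) : ℝ :=
  Real.exp (κ₁ * Real.cos (p.1 - μ₁) + κ₂ * Real.cos (p.2 - μ₂) +
    lam * (Real.sin (p.1 - μ₁) * Real.sin (p.2 - μ₂)))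

/-- The unnormalised density of the bivariate von Mises cosine model. -/
def vmCosineWeight (μ₁ μ₂ κ₁ κ₂ κ₃ : ℝ) (p : ℝ × ℝ) : ℝ :=
  Real.exp (κ₁ * Real.cos (p.1 - μ₁) + κ₂ * Real.cos (p.2 - μ₂) +
    κ₃ * Real.cos (p.1 - μ₁ - p.2 + μ₂))

/-- The probability distribution on `[-π, π)²` whose Lebesgue density is `w` divided by
its total integral over `[-π, π)²`. -/
def angleLaw (w : ℝ × ℝ → ℝ) : Measure (ℝ × ℝ) :=
  (volume.restrict angleSquare).withDensity
    (fun p => ENNReal.ofReal ((∫ q in angleSquare, w q)⁻¹ * w p))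

/-- The bivariate von Mises sine distribution. -/
def vmSine (μ₁ μ₂ κ₁ κ₂ lam : ℝ) : Measure (ℝ × ℝ) :=
  angleLaw (vmSineWeight μ₁ μ₂ κ₁ κ₂ lam)

/-- The bivariate von Mises cosine distribution. -/
def vmCosine (μ₁ μ₂ κ₁ κ₂ κ₃ : ℝ) : Measure (ℝ × ℝ) :=
  angleLaw (vmCosineWeight μ₁ μ₂ κ₁ κ₂ κ₃)

/-- `m` is a circular mean of the random angle `X`: the first trigonometric moment `E[exp(i X)]`
is nonzero and has direction `m`. Such an `m` is unique modulo `2π` when it exists. -/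
def IsCircularMean {Ω : Type*} [MeasurableSpace Ω] (P : Measure Ω) (X : Ω → ℝ) (m : ℝ) : Prop :=
  ∃ R : ℝ, 0 < R ∧
    ∫ ω, Complex.exp (Complex.I * (X ω : ℂ)) ∂P = (R : ℂ) * Complex.exp (Complex.I * (m : ℂ))

/-- The Jammalamadaka-Sarma circular correlation coefficient of the pair of random angles
`(Θ, Φ)`, with `Θ` centred at `m₁` and `Φ` centred at `m₂`. -/
def rhoJS {Ω : Type*} [MeasurableSpace Ω] (P : Measure Ω) (Θ Φ : Ω → ℝ) (m₁ m₂ : ℝ) : ℝ :=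
  (∫ ω, Real.sin (Θ ω - m₁) * Real.sin (Φ ω - m₂) ∂P) /
    Real.sqrt ((∫ ω, Real.sin (Θ ω - m₁) ^ 2 ∂P) * (∫ ω, Real.sin (Φ ω - m₂) ^ 2 ∂P))

end

/-! After centring, both models have weight `exp (h (cos x, cos y) + l sin x sin y)`; for the cosine
model expand `cos (x - y)`, so `l = κ₃`. Everything follows from reflections of the torus.

Put `s = sin x sin y`. Reflecting `x ↦ -x` flips `s` and fixes the cosines, so twice the moment of
`s` is the integral of `2 exp(h) s sinh (l s)`, which has the sign of `l`
(`two_mul_integral_sin_mul_sin`, `sign_integral_sin_mul_sin`).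

Reflecting both angles preserves the weight, so the centred sine moments vanish and a circular mean
satisfies `sin (m - μ) = 0`. Recentring thus multiplies the coefficient by `cos (m₁ - μ₁) cos (m₂ -
μ₂)`, which is `±1` (`rhoJS_eq_of_sin_sub_eq_zero`). In the sine model `x ↦ π - x` shows that the
cosine moments are nonnegative, so both cosines are `1`; the term `κ₃ cos x cos y` blocks this
argument in the cosine model.

A zero coefficient forces `l = 0`, and then the density factorises. -/

/-- A function of a pair of angles that is `2π`-periodic in each of them. -/
def AnglePeriodic (G : ℝ × ℝ → ℝ) : Prop :=
  ∀ x y, G (x + 2 * Real.pi, y) = G (x, y) ∧ G (x, y + 2 * Real.pi) = G (x, y)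

/-- The weight `exp (h (cos x, cos y) + l sin x sin y)`, of which the centred sine and cosine
models are special cases. -/
noncomputable def trigWeight (h : ℝ × ℝ → ℝ) (l : ℝ) (p : ℝ × ℝ) : ℝ :=
  Real.exp (h (Real.cos p.1, Real.cos p.2) + l * (Real.sin p.1 * Real.sin p.2))

theorem trigWeight_pos (h : ℝ × ℝ → ℝ) (l : ℝ) (p : ℝ × ℝ) : 0 < trigWeight h l p :=
  Real.exp_pos _

theorem continuous_trigWeight {h : ℝ × ℝ → ℝ} (hh : Continuous h) (l : ℝ) :
    Continuous (trigWeight h l) := by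
  unfold trigWeight
  fun_prop

theorem anglePeriodic_trigWeight (h : ℝ × ℝ → ℝ) (l : ℝ) : AnglePeriodic (trigWeight h l) := by
  intro x y
  simp [trigWeight]

theorem AnglePeriodic.mul {F G : ℝ × ℝ → ℝ} (hF : AnglePeriodic F) (hG : AnglePeriodic G) :
    AnglePeriodic (fun p => F p * G p) := by
  intro x y
  simp [(hF x y).1, (hF x y).2, (hG x y).1, (hG x y).2]

/-! ### Integrals of periodic functions over the square -/

theorem Continuous.integrableOn_angleSquare {G : ℝ × ℝ → ℝ} (hG : Continuous G) :
    IntegrableOn G angleSquare := by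
  refine (hG.continuousOn.integrableOn_compact (isCompact_Icc.prod isCompact_Icc)).mono_set
    (t := Set.Icc (-Real.pi) Real.pi ×ˢ Set.Icc (-Real.pi) Real.pi) ?_
  exact Set.prod_mono Set.Ico_subset_Icc_self Set.Ico_subset_Icc_self

theorem setIntegral_angleSquare {G : ℝ × ℝ → ℝ} (hG : Continuous G) :
    ∫ p in angleSquare, G p =
      ∫ x in (-Real.pi)..Real.pi, ∫ y in (-Real.pi)..Real.pi, G (x, y) := by
  have hπ : -Real.pi ≤ Real.pi := by linarith [Real.pi_pos]
  simp only [intervalIntegral.integral_of_le hπ, ← integral_Ico_eq_integral_Ioc]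
  exact setIntegral_prod _ hG.integrableOn_angleSquare

theorem setIntegral_angleSquare_swap (G : ℝ × ℝ → ℝ) :
    ∫ p in angleSquare, G p = ∫ p in angleSquare, G (p.2, p.1) := by
  rw [angleSquare, Measure.volume_eq_prod, ← Measure.prod_restrict]
  exact (integral_prod_swap G).symm

theorem Function.Periodic.intervalIntegral_comp_sub_right {f : ℝ → ℝ}
    (hf : Function.Periodic f (2 * Real.pi)) (a : ℝ) :
    ∫ x in (-Real.pi)..Real.pi, f (x - a) = ∫ x in (-Real.pi)..Real.pi, f x := by
  rw [intervalIntegral.integral_comp_sub_right (fun x => f x)]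
  have := hf.intervalIntegral_add_eq (-Real.pi - a) (-Real.pi)
  convert this using 2 <;> ring

theorem Function.Periodic.intervalIntegral_comp_sub_left {f : ℝ → ℝ}
    (hf : Function.Periodic f (2 * Real.pi)) (a : ℝ) :
    ∫ x in (-Real.pi)..Real.pi, f (a - x) = ∫ x in (-Real.pi)..Real.pi, f x := by
  rw [intervalIntegral.integral_comp_sub_left (fun x => f x)]
  have := hf.intervalIntegral_add_eq (a - Real.pi) (-Real.pi)
  convert this using 2 <;> ring

theorem setIntegral_angleSquare_sub {G : ℝ × ℝ → ℝ} (hG : Continuous G) (hp : AnglePeriodic G)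
    (a b : ℝ) :
    ∫ p in angleSquare, G (p.1 - a, p.2 - b) = ∫ p in angleSquare, G p := by
  rw [setIntegral_angleSquare hG, setIntegral_angleSquare (by fun_prop)]
  have h1 (x : ℝ) : ∫ y in (-Real.pi)..Real.pi, G (x, y - b) =
      ∫ y in (-Real.pi)..Real.pi, G (x, y) :=
    Function.Periodic.intervalIntegral_comp_sub_right (f := fun y => G (x, y))
      (fun y => (hp x y).2) b
  simp only [h1]
  exact Function.Periodic.intervalIntegral_comp_sub_right
    (f := fun x => ∫ y in (-Real.pi)..Real.pi, G (x, y)) (fun x => by simp only [(hp x _).1]) a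

theorem setIntegral_angleSquare_reflect_fst {G : ℝ × ℝ → ℝ} (hG : Continuous G)
    (hp : AnglePeriodic G) (a : ℝ) :
    ∫ p in angleSquare, G (a - p.1, p.2) = ∫ p in angleSquare, G p := by
  rw [setIntegral_angleSquare hG, setIntegral_angleSquare (by fun_prop)]
  exact Function.Periodic.intervalIntegral_comp_sub_left
    (f := fun x => ∫ y in (-Real.pi)..Real.pi, G (x, y)) (fun x => by simp only [(hp x _).1]) a

theorem setIntegral_angleSquare_reflect_snd {G : ℝ × ℝ → ℝ} (hG : Continuous G)
    (hp : AnglePeriodic G) (b : ℝ) :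
    ∫ p in angleSquare, G (p.1, b - p.2) = ∫ p in angleSquare, G p := by
  rw [setIntegral_angleSquare_swap G, setIntegral_angleSquare_swap]
  exact setIntegral_angleSquare_reflect_fst (G := fun p => G (p.2, p.1)) (by fun_prop)
    (fun x y => ⟨(hp y x).2, (hp y x).1⟩) b

/-- The test point is `(π/2, π/2)` because both sines equal `1` there, so it serves every integrand
built from sines below. -/
theorem setIntegral_angleSquare_pos {G : ℝ × ℝ → ℝ} (hG : Continuous G) (h0 : ∀ p, 0 ≤ G p)
    (hpos : 0 < G (Real.pi / 2, Real.pi / 2)) : 0 < ∫ p in angleSquare, G p := by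
  have hπ := Real.pi_pos
  have hmem : Real.pi / 2 ∈ Set.Icc (-Real.pi) Real.pi := ⟨by linarith, by linarith⟩
  have hlt : -Real.pi < Real.pi := by linarith
  rw [setIntegral_angleSquare hG]
  refine intervalIntegral.integral_pos hlt ?_ ?_ ⟨Real.pi / 2, hmem, ?_⟩
  · exact (intervalIntegral.continuous_parametric_intervalIntegral_of_continuous'
      (f := fun x y => G (x, y)) (by simpa [Function.uncurry_def] using hG) _ _).continuousOn
  · intro x _
    exact intervalIntegral.integral_nonneg hlt.le fun y _ => h0 _
  · exact intervalIntegral.integral_pos hlt (by fun_prop) (fun y _ => h0 _)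
      ⟨Real.pi / 2, hmem, hpos⟩

/-! ### Sign of the sine product moment -/

theorem sinh_mul_pos {l s : ℝ} (hl : 0 < l) (hs : s ≠ 0) : 0 < s * Real.sinh (l * s) := by
  rcases hs.lt_or_gt with h | h
  · exact mul_pos_of_neg_of_neg h (Real.sinh_neg_iff.2 (mul_neg_of_pos_of_neg hl h))
  · exact mul_pos h (Real.sinh_pos_iff.2 (mul_pos hl h))

/-- Reflecting the first angle symmetrises the moment of `sin x sin y`. -/
theorem two_mul_integral_sin_mul_sin {h : ℝ × ℝ → ℝ} (hh : Continuous h) (l : ℝ) :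
    2 * ∫ p in angleSquare, (Real.sin p.1 * Real.sin p.2) * trigWeight h l p =
      ∫ p in angleSquare, 2 * Real.exp (h (Real.cos p.1, Real.cos p.2)) *
        ((Real.sin p.1 * Real.sin p.2) * Real.sinh (l * (Real.sin p.1 * Real.sin p.2))) := by
  have hw := continuous_trigWeight hh l
  have hc : Continuous fun p : ℝ × ℝ => (Real.sin p.1 * Real.sin p.2) * trigWeight h l p := by
    fun_prop
  have hr := setIntegral_angleSquare_reflect_fst hc
    (AnglePeriodic.mul (fun x y => by simp) (anglePeriodic_trigWeight h l)) 0
  rw [two_mul]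
  -- Only one of the two copies is reflected, so that the two exponentials combine into a `sinh`.
  nth_rw 1 [← hr]
  rw [← integral_add (Continuous.integrableOn_angleSquare (by fun_prop))
    (Continuous.integrableOn_angleSquare hc)]
  congr 1
  ext p
  simp only [trigWeight, zero_sub, Real.cos_neg, Real.sin_neg, Real.exp_add, Real.sinh_eq]
  ring_nf

theorem integral_sin_mul_sin_pos {h : ℝ × ℝ → ℝ} (hh : Continuous h) {l : ℝ} (hl : 0 < l) :
    0 < ∫ p in angleSquare, (Real.sin p.1 * Real.sin p.2) * trigWeight h l p := by
  have key := two_mul_integral_sin_mul_sin hh l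
  have : 0 < ∫ p in angleSquare, 2 * Real.exp (h (Real.cos p.1, Real.cos p.2)) *
        ((Real.sin p.1 * Real.sin p.2) * Real.sinh (l * (Real.sin p.1 * Real.sin p.2))) := by
    refine setIntegral_angleSquare_pos (by fun_prop) (fun p => ?_) ?_
    · refine mul_nonneg (by positivity) ?_
      by_cases hs : Real.sin p.1 * Real.sin p.2 = 0
      · simp [hs]
      · exact (sinh_mul_pos hl hs).le
    · refine mul_pos (by positivity) (sinh_mul_pos hl ?_)
      simp
  linarith

/-- Since `sinh` is odd, the symmetrised integral is odd in the coupling; this settles negative and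
zero coupling at once. -/
theorem integral_sin_mul_sin_neg_coupling {h : ℝ × ℝ → ℝ} (hh : Continuous h) (l : ℝ) :
    ∫ p in angleSquare, (Real.sin p.1 * Real.sin p.2) * trigWeight h (-l) p =
      -∫ p in angleSquare, (Real.sin p.1 * Real.sin p.2) * trigWeight h l p := by
  have h1 := two_mul_integral_sin_mul_sin hh l
  have h2 := two_mul_integral_sin_mul_sin hh (-l)
  simp only [neg_mul, Real.sinh_neg, mul_neg, integral_neg] at h2
  linarith

theorem sign_integral_sin_mul_sin {h : ℝ × ℝ → ℝ} (hh : Continuous h) (l : ℝ) :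
    SignType.sign (∫ p in angleSquare, (Real.sin p.1 * Real.sin p.2) * trigWeight h l p) =
      SignType.sign l := by
  have hneg := integral_sin_mul_sin_neg_coupling hh l
  rcases lt_trichotomy l 0 with hl | rfl | hl
  · have := integral_sin_mul_sin_pos hh (neg_pos.2 hl)
    rw [sign_neg hl, sign_neg (by linarith)]
  · rw [neg_zero] at hneg
    rw [show ∫ p in angleSquare, (Real.sin p.1 * Real.sin p.2) * trigWeight h 0 p = 0 by linarith]
  · rw [sign_pos hl, sign_pos (integral_sin_mul_sin_pos hh hl)]

theorem integral_sq_sin_pos {h : ℝ × ℝ → ℝ} (hh : Continuous h) (l : ℝ) :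
    0 < (∫ p in angleSquare, Real.sin p.1 ^ 2 * trigWeight h l p) ∧
      0 < ∫ p in angleSquare, Real.sin p.2 ^ 2 * trigWeight h l p := by
  have hw := continuous_trigWeight hh l
  constructor <;>
    exact setIntegral_angleSquare_pos (by fun_prop)
      (fun p => mul_nonneg (sq_nonneg _) (trigWeight_pos h l p).le)
      (by simpa using trigWeight_pos h l _)

theorem integral_trigWeight_pos {h : ℝ × ℝ → ℝ} (hh : Continuous h) (l : ℝ) :
    0 < ∫ p in angleSquare, trigWeight h l p :=
  setIntegral_angleSquare_pos (continuous_trigWeight hh l)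
    (fun p => (trigWeight_pos h l p).le) (trigWeight_pos h l _)

/-! ### First trigonometric moments of the centred weight -/

/-- A function that is odd under reflection of both angles integrates to zero. -/
theorem setIntegral_angleSquare_eq_zero_of_odd {G : ℝ × ℝ → ℝ} (hG : Continuous G)
    (hp : AnglePeriodic G) (hodd : ∀ x y, G (-x, -y) = -G (x, y)) :
    ∫ p in angleSquare, G p = 0 := by
  have h1 := setIntegral_angleSquare_reflect_fst hG hp 0
  have h2 := setIntegral_angleSquare_reflect_snd (G := fun p => G (-p.1, p.2)) (by fun_prop)
    (fun x y => ⟨?_, (hp _ y).2⟩) 0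
  · simp only [zero_sub, hodd, integral_neg] at h1 h2
    linarith
  · beta_reduce
    rw [neg_add, ← (hp (-x + -(2 * Real.pi)) y).1, neg_add_cancel_right]

theorem integral_sin_eq_zero {h : ℝ × ℝ → ℝ} (hh : Continuous h) (l : ℝ) :
    (∫ p in angleSquare, Real.sin p.1 * trigWeight h l p) = 0 ∧
      (∫ p in angleSquare, Real.sin p.2 * trigWeight h l p) = 0 := by
  have hw := continuous_trigWeight hh l
  constructor <;>
    exact setIntegral_angleSquare_eq_zero_of_odd (by fun_prop)
      (AnglePeriodic.mul (fun x y => by simp) (anglePeriodic_trigWeight h l))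
      (fun x y => by simp [trigWeight])

theorem mul_exp_sub_nonneg {k : ℝ} (hk : 0 ≤ k) (c : ℝ) :
    0 ≤ c * (Real.exp (k * c) - Real.exp (-(k * c))) := by
  rcases le_total 0 c with hc | hc
  · exact mul_nonneg hc (sub_nonneg.2 (Real.exp_le_exp.2 (by linarith [mul_nonneg hk hc])))
  · exact mul_nonneg_of_nonpos_of_nonpos hc
      (sub_nonpos.2 (Real.exp_le_exp.2 (by linarith [mul_nonpos_of_nonneg_of_nonpos hk hc])))

/-- The reflection `x ↦ π - x` fixes the sine and flips the cosine. Averaging over it leaves a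
positive factor times `c (exp (κ c) - exp (-κ c))` with `c` the cosine. Linearity of the exponent in
each cosine separately is essential. -/
theorem integral_cos_nonneg {κ₁ κ₂ : ℝ} (hκ₁ : 0 ≤ κ₁) (hκ₂ : 0 ≤ κ₂) (l : ℝ) :
    0 ≤ (∫ p in angleSquare,
        Real.cos p.1 * trigWeight (fun q => κ₁ * q.1 + κ₂ * q.2) l p) ∧
      0 ≤ ∫ p in angleSquare,
        Real.cos p.2 * trigWeight (fun q => κ₁ * q.1 + κ₂ * q.2) l p := by
  have hw := continuous_trigWeight (h := fun q => κ₁ * q.1 + κ₂ * q.2) (by fun_prop) l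
  have hp := anglePeriodic_trigWeight (fun q => κ₁ * q.1 + κ₂ * q.2) l
  constructor
  · have hc : Continuous fun p : ℝ × ℝ =>
        Real.cos p.1 * trigWeight (fun q => κ₁ * q.1 + κ₂ * q.2) l p := by fun_prop
    have hr := setIntegral_angleSquare_reflect_fst hc
      (AnglePeriodic.mul (fun x y => by simp) hp) Real.pi
    have hsum := integral_add (μ := volume.restrict angleSquare)
      (Continuous.integrableOn_angleSquare (hc.comp
        (g := _) (f := fun p : ℝ × ℝ => (Real.pi - p.1, p.2)) (by fun_prop)))
      (Continuous.integrableOn_angleSquare hc)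
    have h0 : 0 ≤ ∫ p in angleSquare, (Real.cos (Real.pi - p.1) *
        trigWeight (fun q => κ₁ * q.1 + κ₂ * q.2) l (Real.pi - p.1, p.2) +
        Real.cos p.1 * trigWeight (fun q => κ₁ * q.1 + κ₂ * q.2) l p) := by
      refine integral_nonneg fun p => ?_
      have := mul_nonneg (Real.exp_pos (κ₂ * Real.cos p.2 +
        l * (Real.sin p.1 * Real.sin p.2))).le (mul_exp_sub_nonneg hκ₁ (Real.cos p.1))
      simp only [Pi.zero_apply, trigWeight, Real.cos_pi_sub, Real.sin_pi_sub, mul_neg,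
        Real.exp_add] at this ⊢
      linarith
    simp only [Function.comp_def] at hsum
    linarith
  · have hc : Continuous fun p : ℝ × ℝ =>
        Real.cos p.2 * trigWeight (fun q => κ₁ * q.1 + κ₂ * q.2) l p := by fun_prop
    have hr := setIntegral_angleSquare_reflect_snd hc
      (AnglePeriodic.mul (fun x y => by simp) hp) Real.pi
    have hsum := integral_add (μ := volume.restrict angleSquare)
      (Continuous.integrableOn_angleSquare (hc.comp
        (g := _) (f := fun p : ℝ × ℝ => (p.1, Real.pi - p.2)) (by fun_prop)))
      (Continuous.integrableOn_angleSquare hc)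
    have h0 : 0 ≤ ∫ p in angleSquare, (Real.cos (Real.pi - p.2) *
        trigWeight (fun q => κ₁ * q.1 + κ₂ * q.2) l (p.1, Real.pi - p.2) +
        Real.cos p.2 * trigWeight (fun q => κ₁ * q.1 + κ₂ * q.2) l p) := by
      refine integral_nonneg fun p => ?_
      have := mul_nonneg (Real.exp_pos (κ₁ * Real.cos p.1 +
        l * (Real.sin p.1 * Real.sin p.2))).le (mul_exp_sub_nonneg hκ₂ (Real.cos p.2))
      simp only [Pi.zero_apply, trigWeight, Real.cos_pi_sub, Real.sin_pi_sub, mul_neg,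
        Real.exp_add] at this ⊢
      linarith
    simp only [Function.comp_def] at hsum
    linarith

/-! ### Expectations, correlation and circular means under the law -/

section Law

variable {Ω : Type*} [MeasurableSpace Ω] {P : Measure Ω} {Θ Φ : Ω → ℝ} {μ₁ μ₂ l : ℝ}
  {h : ℝ × ℝ → ℝ}

/-- Expectations under the law with a shifted weight, as integrals against the centred weight. -/
theorem integral_eq_of_hasLaw_trigWeight (hh : Continuous h)
    (hlaw : HasLaw (fun ω => (Θ ω, Φ ω))
      (angleLaw fun p => trigWeight h l (p.1 - μ₁, p.2 - μ₂)) P)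
    {F : ℝ × ℝ → ℝ} (hF : Continuous F) (hFp : AnglePeriodic F) :
    ∫ ω, F (Θ ω - μ₁, Φ ω - μ₂) ∂P =
      (∫ p in angleSquare, trigWeight h l p)⁻¹ * ∫ p in angleSquare, F p * trigWeight h l p := by
  have hw := continuous_trigWeight hh l
  have hwp := anglePeriodic_trigWeight h l
  have hZ : ∫ q in angleSquare, trigWeight h l (q.1 - μ₁, q.2 - μ₂) =
      ∫ p in angleSquare, trigWeight h l p := setIntegral_angleSquare_sub hw hwp μ₁ μ₂
  have hc : Continuous fun p : ℝ × ℝ => F (p.1 - μ₁, p.2 - μ₂) := by fun_prop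
  have h1 := hlaw.integral_comp hc.aestronglyMeasurable
  simp only [Function.comp_def] at h1
  rw [h1, angleLaw, hZ, integral_withDensity_eq_integral_toReal_smul
    (by fun_prop) (by simp), ← integral_const_mul,
    ← setIntegral_angleSquare_sub (G := fun p => _ * (F p * trigWeight h l p)) (by fun_prop) ?_
      μ₁ μ₂]
  · congr 1
    ext p
    rw [ENNReal.toReal_ofReal, smul_eq_mul]
    · ring
    · exact mul_nonneg (inv_nonneg.2 (integral_trigWeight_pos hh l).le) (trigWeight_pos _ _ _).le
  · exact AnglePeriodic.mul (fun x y => by simp) (hFp.mul hwp)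

theorem sign_rhoJS_of_hasLaw (hh : Continuous h)
    (hlaw : HasLaw (fun ω => (Θ ω, Φ ω))
      (angleLaw fun p => trigWeight h l (p.1 - μ₁, p.2 - μ₂)) P) :
    SignType.sign (rhoJS P Θ Φ μ₁ μ₂) = SignType.sign l := by
  have hZ := inv_pos.2 (integral_trigWeight_pos hh l)
  have e1 := integral_eq_of_hasLaw_trigWeight hh hlaw
    (F := fun p => Real.sin p.1 * Real.sin p.2) (by fun_prop) (fun x y => by simp)
  have e2 := integral_eq_of_hasLaw_trigWeight hh hlaw
    (F := fun p => Real.sin p.1 ^ 2) (by fun_prop) (fun x y => by simp)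
  have e3 := integral_eq_of_hasLaw_trigWeight hh hlaw
    (F := fun p => Real.sin p.2 ^ 2) (by fun_prop) (fun x y => by simp)
  simp only at e1 e2 e3
  obtain ⟨p2, p3⟩ := integral_sq_sin_pos hh l
  rw [rhoJS, e1, e2, e3, div_eq_mul_inv, sign_mul, sign_mul, sign_pos hZ,
    sign_integral_sin_mul_sin hh l,
    sign_pos (inv_pos.2 (Real.sqrt_pos.2 (mul_pos (mul_pos hZ p2) (mul_pos hZ p3))))]
  simp

/-- A circular mean is determined by the first centred trigonometric moments. -/
theorem IsCircularMean.centred [IsFiniteMeasure P] {X : Ω → ℝ} (hX : AEMeasurable X P) {m : ℝ}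
    (hm : IsCircularMean P X m) (μ : ℝ) :
    ∃ R : ℝ, 0 < R ∧ ∫ ω, Real.cos (X ω - μ) ∂P = R * Real.cos (m - μ) ∧
      ∫ ω, Real.sin (X ω - μ) ∂P = R * Real.sin (m - μ) := by
  obtain ⟨R, hR, he⟩ := hm
  refine ⟨R, hR, ?_⟩
  have hexp (x : ℝ) : Complex.exp (Complex.I * (x : ℂ)) * Complex.exp (-(Complex.I * (μ : ℂ))) =
      Complex.exp (((x - μ : ℝ) : ℂ) * Complex.I) := by
    rw [← Complex.exp_add]
    push_cast
    ring_nf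
  have hint : Integrable (fun ω => Complex.exp (((X ω - μ : ℝ) : ℂ) * Complex.I)) P := by
    refine Integrable.of_bound (C := 1) ?_ (ae_of_all _ fun ω => ?_)
    · have hc : Continuous fun x : ℝ => Complex.exp (((x - μ : ℝ) : ℂ) * Complex.I) := by
        fun_prop
      exact (hc.measurable.comp_aemeasurable hX).aestronglyMeasurable
    · rw [Complex.norm_exp_ofReal_mul_I]
  have key : ∫ ω, Complex.exp (((X ω - μ : ℝ) : ℂ) * Complex.I) ∂P =
      (R : ℂ) * Complex.exp (((m - μ : ℝ) : ℂ) * Complex.I) := by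
    simp only [← hexp]
    rw [integral_mul_const, he, mul_assoc]
  have hre := integral_re hint
  have him := integral_im hint
  rw [key] at hre him
  simp only [RCLike.re_to_complex, RCLike.im_to_complex, Complex.exp_ofReal_mul_I_re,
    Complex.exp_ofReal_mul_I_im, Complex.re_ofReal_mul, Complex.im_ofReal_mul] at hre him
  exact ⟨hre, him⟩

theorem sin_circularMean_sub_eq_zero [IsFiniteMeasure P] (hh : Continuous h)
    (hlaw : HasLaw (fun ω => (Θ ω, Φ ω))
      (angleLaw fun p => trigWeight h l (p.1 - μ₁, p.2 - μ₂)) P) {m₁ m₂ : ℝ}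
    (hm₁ : IsCircularMean P Θ m₁) (hm₂ : IsCircularMean P Φ m₂) :
    Real.sin (m₁ - μ₁) = 0 ∧ Real.sin (m₂ - μ₂) = 0 := by
  obtain ⟨R₁, hR₁, -, h₁⟩ := hm₁.centred hlaw.aemeasurable.fst μ₁
  obtain ⟨R₂, hR₂, -, h₂⟩ := hm₂.centred hlaw.aemeasurable.snd μ₂
  have e1 := integral_eq_of_hasLaw_trigWeight hh hlaw
    (F := fun p => Real.sin p.1) (by fun_prop) (fun x y => by simp)
  have e2 := integral_eq_of_hasLaw_trigWeight hh hlaw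
    (F := fun p => Real.sin p.2) (by fun_prop) (fun x y => by simp)
  obtain ⟨z1, z2⟩ := integral_sin_eq_zero hh l
  simp only at e1 e2
  rw [z1, mul_zero, h₁] at e1
  rw [z2, mul_zero, h₂] at e2
  exact ⟨(mul_eq_zero.1 e1).resolve_left hR₁.ne', (mul_eq_zero.1 e2).resolve_left hR₂.ne'⟩

/-- Each centre moves by a multiple of `π`, so each sine is multiplied by a sign; the signs survive
in the numerator and square to `1` in the denominator. -/
theorem rhoJS_eq_of_sin_sub_eq_zero {m₁ m₂ : ℝ} (h₁ : Real.sin (m₁ - μ₁) = 0)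
    (h₂ : Real.sin (m₂ - μ₂) = 0) :
    rhoJS P Θ Φ m₁ m₂ =
      (Real.cos (m₁ - μ₁) * Real.cos (m₂ - μ₂)) * rhoJS P Θ Φ μ₁ μ₂ := by
  have e1 (x : ℝ) : Real.sin (x - m₁) = Real.sin (x - μ₁) * Real.cos (m₁ - μ₁) := by
    rw [← sub_sub_sub_cancel_right x m₁ μ₁, Real.sin_sub, h₁, mul_zero, sub_zero]
  have e2 (x : ℝ) : Real.sin (x - m₂) = Real.sin (x - μ₂) * Real.cos (m₂ - μ₂) := by
    rw [← sub_sub_sub_cancel_right x m₂ μ₂, Real.sin_sub, h₂, mul_zero, sub_zero]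
  have c1 : Real.cos (m₁ - μ₁) ^ 2 = 1 := by rw [Real.cos_sq', h₁]; simp
  have c2 : Real.cos (m₂ - μ₂) ^ 2 = 1 := by rw [Real.cos_sq', h₂]; simp
  have e (x y : ℝ) : Real.sin (x - m₁) * Real.sin (y - m₂) =
      (Real.sin (x - μ₁) * Real.sin (y - μ₂)) * (Real.cos (m₁ - μ₁) * Real.cos (m₂ - μ₂)) := by
    rw [e1, e2, mul_mul_mul_comm]
  simp only [rhoJS, e, integral_mul_const]
  simp only [e1, e2, mul_pow, c1, c2, mul_one]
  ring

theorem sign_rhoJS_of_isCircularMean [IsFiniteMeasure P] (hh : Continuous h)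
    (hlaw : HasLaw (fun ω => (Θ ω, Φ ω))
      (angleLaw fun p => trigWeight h l (p.1 - μ₁, p.2 - μ₂)) P) {m₁ m₂ : ℝ}
    (hm₁ : IsCircularMean P Θ m₁) (hm₂ : IsCircularMean P Φ m₂) :
    SignType.sign (rhoJS P Θ Φ m₁ m₂) = SignType.sign l *
      (SignType.sign (Real.cos (m₁ - μ₁)) * SignType.sign (Real.cos (m₂ - μ₂))) := by
  obtain ⟨h₁, h₂⟩ := sin_circularMean_sub_eq_zero hh hlaw hm₁ hm₂
  rw [rhoJS_eq_of_sin_sub_eq_zero h₁ h₂, sign_mul, sign_mul, sign_rhoJS_of_hasLaw hh hlaw,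
    mul_comm]

theorem coupling_eq_zero_of_rhoJS_eq_zero [IsFiniteMeasure P] (hh : Continuous h)
    (hlaw : HasLaw (fun ω => (Θ ω, Φ ω))
      (angleLaw fun p => trigWeight h l (p.1 - μ₁, p.2 - μ₂)) P) {m₁ m₂ : ℝ}
    (hm₁ : IsCircularMean P Θ m₁) (hm₂ : IsCircularMean P Φ m₂)
    (h0 : rhoJS P Θ Φ m₁ m₂ = 0) : l = 0 := by
  obtain ⟨h₁, h₂⟩ := sin_circularMean_sub_eq_zero hh hlaw hm₁ hm₂
  rw [rhoJS_eq_of_sin_sub_eq_zero h₁ h₂] at h0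
  have c1 : Real.cos (m₁ - μ₁) ≠ 0 := fun hc => by
    simpa [h₁, hc] using Real.sin_sq_add_cos_sq (m₁ - μ₁)
  have c2 : Real.cos (m₂ - μ₂) ≠ 0 := fun hc => by
    simpa [h₂, hc] using Real.sin_sq_add_cos_sq (m₂ - μ₂)
  have hρ := (mul_eq_zero.1 h0).resolve_left (mul_ne_zero c1 c2)
  rw [← sign_eq_zero_iff, ← sign_rhoJS_of_hasLaw hh hlaw, hρ, sign_zero]

theorem cos_circularMean_sub_eq_one [IsFiniteMeasure P] {κ₁ κ₂ : ℝ} (hκ₁ : 0 ≤ κ₁) (hκ₂ : 0 ≤ κ₂)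
    (hlaw : HasLaw (fun ω => (Θ ω, Φ ω)) (angleLaw fun p =>
      trigWeight (fun q => κ₁ * q.1 + κ₂ * q.2) l (p.1 - μ₁, p.2 - μ₂)) P) {m₁ m₂ : ℝ}
    (hm₁ : IsCircularMean P Θ m₁) (hm₂ : IsCircularMean P Φ m₂) :
    Real.cos (m₁ - μ₁) = 1 ∧ Real.cos (m₂ - μ₂) = 1 := by
  have hh : Continuous fun q : ℝ × ℝ => κ₁ * q.1 + κ₂ * q.2 := by fun_prop
  obtain ⟨s₁, s₂⟩ := sin_circularMean_sub_eq_zero hh hlaw hm₁ hm₂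
  obtain ⟨R₁, hR₁, h₁, -⟩ := hm₁.centred hlaw.aemeasurable.fst μ₁
  obtain ⟨R₂, hR₂, h₂, -⟩ := hm₂.centred hlaw.aemeasurable.snd μ₂
  have hZ := inv_pos.2 (integral_trigWeight_pos hh l)
  have e1 := integral_eq_of_hasLaw_trigWeight hh hlaw
    (F := fun p => Real.cos p.1) (by fun_prop) (fun x y => by simp)
  have e2 := integral_eq_of_hasLaw_trigWeight hh hlaw
    (F := fun p => Real.cos p.2) (by fun_prop) (fun x y => by simp)
  obtain ⟨z1, z2⟩ := integral_cos_nonneg hκ₁ hκ₂ l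
  have c1 : 0 ≤ Real.cos (m₁ - μ₁) :=
    nonneg_of_mul_nonneg_right (h₁ ▸ e1 ▸ mul_nonneg hZ.le z1) hR₁
  have c2 : 0 ≤ Real.cos (m₂ - μ₂) :=
    nonneg_of_mul_nonneg_right (h₂ ▸ e2 ▸ mul_nonneg hZ.le z2) hR₂
  -- Each cosine is `1` or `-1`, and nonnegativity excludes `-1`.
  rcases Real.sin_eq_zero_iff_cos_eq.1 s₁ with a | a <;>
    rcases Real.sin_eq_zero_iff_cos_eq.1 s₂ with b | b <;>
    first
      | exact ⟨a, b⟩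
      | linarith

/-! ### Independence at zero coupling -/

/-- The factors need not be normalised: the marginals are `α` and `β` rescaled by each other's total
mass, and these masses multiply to `1`. -/
theorem indepFun_of_map_eq_prod [IsProbabilityMeasure P] {α β : Measure ℝ} [SFinite α] [SFinite β]
    (hX : AEMeasurable (fun ω => (Θ ω, Φ ω)) P)
    (hmap : P.map (fun ω => (Θ ω, Φ ω)) = α.prod β) : IndepFun Θ Φ P := by
  have hΘ : AEMeasurable Θ P := hX.fst
  have hΦ : AEMeasurable Φ P := hX.snd
  have h1 : α Set.univ * β Set.univ = 1 := by
    have : IsProbabilityMeasure (P.map fun ω => (Θ ω, Φ ω)) :=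
      Measure.isProbabilityMeasure_map hX
    rw [← Measure.prod_prod, ← hmap, Set.univ_prod_univ, measure_univ]
  have e1 : P.map Θ = β Set.univ • α := by
    rw [← Measure.map_fst_prod, ← hmap, AEMeasurable.map_map_of_aemeasurable
      measurable_fst.aemeasurable hX]
    rfl
  have e2 : P.map Φ = α Set.univ • β := by
    rw [← Measure.map_snd_prod, ← hmap, AEMeasurable.map_map_of_aemeasurable
      measurable_snd.aemeasurable hX]
    rfl
  rw [indepFun_iff_map_prod_eq_prod_map_map hΘ hΦ, hmap, e1, e2, Measure.prod_smul_left,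
    Measure.prod_smul_right, smul_smul, mul_comm, h1, one_smul]

theorem indepFun_of_coupling_eq_zero [IsProbabilityMeasure P] {κ₁ κ₂ : ℝ}
    (hlaw : HasLaw (fun ω => (Θ ω, Φ ω)) (angleLaw fun p =>
      trigWeight (fun q => κ₁ * q.1 + κ₂ * q.2) 0 (p.1 - μ₁, p.2 - μ₂)) P) :
    IndepFun Θ Φ P := by
  set Z := ∫ p in angleSquare,
    trigWeight (fun q => κ₁ * q.1 + κ₂ * q.2) 0 (p.1 - μ₁, p.2 - μ₂) with hZdef
  have hZ : 0 ≤ Z⁻¹ := inv_nonneg.2 (integral_nonneg fun p => (trigWeight_pos _ _ _).le)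
  refine indepFun_of_map_eq_prod hlaw.aemeasurable
    -- The whole normalising constant goes into the first factor, so the separate marginal constants
    -- are never needed.
    (α := (volume.restrict (Set.Ico (-Real.pi) Real.pi)).withDensity
      fun x => ENNReal.ofReal (Z⁻¹ * Real.exp (κ₁ * Real.cos (x - μ₁))))
    (β := (volume.restrict (Set.Ico (-Real.pi) Real.pi)).withDensity
      fun y => ENNReal.ofReal (Real.exp (κ₂ * Real.cos (y - μ₂)))) ?_
  rw [hlaw.map_eq, prod_withDensity (by fun_prop) (by fun_prop), Measure.prod_restrict, angleLaw,
    ← hZdef]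
  congr 1
  ext p
  rw [← ENNReal.ofReal_mul (mul_nonneg hZ (Real.exp_pos _).le)]
  simp only [trigWeight, zero_mul, add_zero, Real.exp_add, mul_assoc]

end Law

/-! ### The two von Mises models -/

theorem vmSine_eq (μ₁ μ₂ κ₁ κ₂ lam : ℝ) :
    vmSine μ₁ μ₂ κ₁ κ₂ lam = angleLaw fun p =>
      trigWeight (fun q => κ₁ * q.1 + κ₂ * q.2) lam (p.1 - μ₁, p.2 - μ₂) := rfl

theorem vmCosine_eq (μ₁ μ₂ κ₁ κ₂ κ₃ : ℝ) :
    vmCosine μ₁ μ₂ κ₁ κ₂ κ₃ = angleLaw fun p =>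
      trigWeight (fun q => κ₁ * q.1 + κ₂ * q.2 + κ₃ * (q.1 * q.2)) κ₃
        (p.1 - μ₁, p.2 - μ₂) := by
  rw [vmCosine]
  congr 1
  ext p
  rw [vmCosineWeight, trigWeight, show p.1 - μ₁ - p.2 + μ₂ = (p.1 - μ₁) - (p.2 - μ₂) by ring,
    Real.cos_sub (p.1 - μ₁)]
  congr 1
  ring

theorem corollary1 {Ω : Type*} [MeasurableSpace Ω] (P : Measure Ω) [IsProbabilityMeasure P]
    (Θ Φ : Ω → ℝ) (μ₁ μ₂ κ₁ κ₂ : ℝ)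
    (hμ₁ : μ₁ ∈ Set.Ico (-Real.pi) Real.pi) (hμ₂ : μ₂ ∈ Set.Ico (-Real.pi) Real.pi)
    (hκ₁ : 0 ≤ κ₁) (hκ₂ : 0 ≤ κ₂) :
    -- the sine model
    (∀ lam : ℝ, HasLaw (fun ω => (Θ ω, Φ ω)) (vmSine μ₁ μ₂ κ₁ κ₂ lam) P →
      (SignType.sign (rhoJS P Θ Φ μ₁ μ₂) = SignType.sign lam ∧
        (rhoJS P Θ Φ μ₁ μ₂ = 0 → IndepFun Θ Φ P)) ∧
      ∀ m₁ m₂ : ℝ, IsCircularMean P Θ m₁ → IsCircularMean P Φ m₂ →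
        SignType.sign (rhoJS P Θ Φ m₁ m₂) = SignType.sign lam ∧
        (rhoJS P Θ Φ m₁ m₂ = 0 → IndepFun Θ Φ P)) ∧
    -- the cosine model
    (∀ κ₃ : ℝ, HasLaw (fun ω => (Θ ω, Φ ω)) (vmCosine μ₁ μ₂ κ₁ κ₂ κ₃) P →
      (SignType.sign (rhoJS P Θ Φ μ₁ μ₂) = SignType.sign κ₃ ∧
        (rhoJS P Θ Φ μ₁ μ₂ = 0 → IndepFun Θ Φ P)) ∧
      ∀ m₁ m₂ : ℝ, IsCircularMean P Θ m₁ → IsCircularMean P Φ m₂ →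
        SignType.sign (rhoJS P Θ Φ m₁ m₂) = SignType.sign κ₃ *
          (SignType.sign (Real.cos (m₁ - μ₁)) * SignType.sign (Real.cos (m₂ - μ₂))) ∧
        (rhoJS P Θ Φ m₁ m₂ = 0 → IndepFun Θ Φ P)) := by
  constructor
  · intro lam hlaw
    rw [vmSine_eq] at hlaw
    have hh : Continuous fun q : ℝ × ℝ => κ₁ * q.1 + κ₂ * q.2 := by fun_prop
    have hind (hl : lam = 0) : IndepFun Θ Φ P := by
      subst hl
      exact indepFun_of_coupling_eq_zero hlaw
    have hs := sign_rhoJS_of_hasLaw hh hlaw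
    refine ⟨⟨hs, fun h0 => hind ?_⟩, fun m₁ m₂ hm₁ hm₂ => ⟨?_, fun h0 => hind ?_⟩⟩
    · rw [← sign_eq_zero_iff, ← hs, h0, sign_zero]
    · obtain ⟨c₁, c₂⟩ := cos_circularMean_sub_eq_one hκ₁ hκ₂ hlaw hm₁ hm₂
      rw [sign_rhoJS_of_isCircularMean hh hlaw hm₁ hm₂, c₁, c₂]
      simp
    · exact coupling_eq_zero_of_rhoJS_eq_zero hh hlaw hm₁ hm₂ h0
  · intro κ₃ hlaw
    rw [vmCosine_eq] at hlaw
    have hh : Continuous fun q : ℝ × ℝ => κ₁ * q.1 + κ₂ * q.2 + κ₃ * (q.1 * q.2) := by fun_prop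
    have hind (hl : κ₃ = 0) : IndepFun Θ Φ P := by
      subst hl
      -- At `κ₃ = 0` the mixed cosine term disappears too, leaving the uncoupled sine model.
      simp only [zero_mul, add_zero] at hlaw
      exact indepFun_of_coupling_eq_zero hlaw
    have hs := sign_rhoJS_of_hasLaw hh hlaw
    refine ⟨⟨hs, fun h0 => hind ?_⟩, fun m₁ m₂ hm₁ hm₂ =>
      ⟨sign_rhoJS_of_isCircularMean hh hlaw hm₁ hm₂, fun h0 => hind ?_⟩⟩
    · rw [← sign_eq_zero_iff, ← hs, h0, sign_zero]
    · exact coupling_eq_zero_of_rhoJS_eq_zero hh hlaw hm₁ hm₂ h0
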